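/- For $n\ge 5$ let $\mathcal D_n=(Q_n,\Sigma,\delta,1,\{n\})$ be the DFA with state set $Q_n=\{1,\dots,n\}$, alphabet $\Sigma=\{a,b,c,d,e,f\}$, initial state $1$, only final state $n$, and transitions given by the following transformations of $Q_n$ (all states not mentioned are fixed): $a$ is the cycle $(2,3,\dots,n-1)$; $b$ is the transposition $(2,3)$; $c$ maps $n-1$ to $2$; $d$ maps $n-1$ to $1$; $e$ maps every state of $\{1,\dots,n-1\}$ to $2$; $f$ maps $2$ to $n$. Let $L_n(a,b,-,d,e,f)$ be the language over the five-letter alphabet $\{a,b,d,e,f\}$ that consists of the words over this alphabet accepted by $\mathcal D_n$ (that is, the language of the DFA obtained from $\mathcal D_n$ by deleting the letter $c$). The complexity of a language $L$ over an alphabet $\Gamma$ is the number of distinct left quotients $w^{-1}L=\{x\in\Gamma^*\mid wx\in L\}$, $w\in\Gamma^*$; for regular $L$ it equals the number of states of a minimal complete DFA of $L$ over $\Gamma$. **Theorem (Two-Sided Ideals: Boolean Operations, $m\ne n$).** Suppose $m,n\ge 5$ and $m\neq n$. Then, over the alphabet $\{a,b,d,e,f\}$: 1. the complexity of $L_m(a,b,-,d,e,f)\cap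 L_n(a,b,-,d,e,f)$ is $mn$; 2. the complexity of $L_m(a,b,-,d,e,f)\oplus L_n(a,b,-,d,e,f)$ (symmetric difference) is $mn$; 3. the complexity of $L_m(a,b,-,d,e,f)\setminus L_n(a,b,-,d,e,f)$ is $mn-(m-1)$; 4. the complexity of $L_m(a,b,-,d,e,f)\cup L_n(a,b,-,d,e,f)$ is $mn-(m+n-2)$. -/

import Mathlib

namespace IdealStream

/-- Quotient complexity of a language over the alphabet `α`: the number of its distinct
left quotients `w⁻¹L`, `w` ranging over all words over `α`. -/
noncomputable def complexity {α : Type*} (L : Language α) : ℕ∞ :=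
  (Set.range L.leftQuotient).encard

/-- The image `π(α)` of a partial permutation `π` of `α`; it is the alphabet of the dialect. -/
abbrev DialectAlphabet {α : Type*} (π : α ≃. α) : Type _ :=
  {y : α // ∃ x : α, y ∈ π x}

/-- The permutational dialect of `L` given by `π`: the image of `L` under the substitution that
replaces a letter `x` by `π x` where `π x` is defined, and by the empty language otherwise,
as a language over the alphabet `π(α)`. Thus a word `u ∈ L` contributes only if `π` is defined on
all letters of `u`, and then it contributes the word obtained by applying `π` letter by letter. -/
def dialect {α : Type*} (π : α ≃. α) (L : Language α) : Language (DialectAlphabet π) :=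
  {w | ∃ u ∈ L, u.map π = w.map (fun y => some y.val)}

/-- The six-letter alphabet `Σ = {a, b, c, d, e, f}`. -/
inductive Letter : Type
  | a | b | c | d | e | f
  deriving DecidableEq

/-- The state set `Q_n = {1, 2, …, n}`. -/
abbrev State (n : ℕ) : Type := {q : ℕ // 1 ≤ q ∧ q ≤ n}

/-- The transformation of `Q_n` induced by each letter:
`a : (2, 3, …, n-1)`, `b : (2, 3)`, `c : (n-1 → 2)`, `d : (n-1 → 1)`, `e : (Q_{n-1} → 2)`,
`f : (2 → n)`. -/
def act (n : ℕ) : Letter → ℕ → ℕ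
  | .a, q => if q = n - 1 then 2 else if 2 ≤ q ∧ q ≤ n - 2 then q + 1 else q
  | .b, q => if q = 2 then 3 else if q = 3 then 2 else q
  | .c, q => if q = n - 1 then 2 else q
  | .d, q => if q = n - 1 then 1 else q
  | .e, q => if q ≤ n - 1 then 2 else q
  | .f, q => if q = 2 then n else q

theorem act_mem {n : ℕ} (hn : 5 ≤ n) (x : Letter) {q : ℕ} (hq : 1 ≤ q ∧ q ≤ n) :
    1 ≤ act n x q ∧ act n x q ≤ n := by
  cases x <;> simp only [act] <;> split_ifs <;> omega

/-- The DFA `D_n(a,b,c,d,e,f)`, `n ≥ 5`, with initial state `1` and set of final states `{n}`. -/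
def automaton (n : ℕ) (hn : 5 ≤ n) : DFA Letter (State n) where
  step q x := ⟨act n x q.val, act_mem hn x q.property⟩
  start := ⟨1, by omega⟩
  accept := {q | q.val = n}

/-- The language `L_n(a,b,c,d,e,f)`. -/
def stream (n : ℕ) (hn : 5 ≤ n) : Language Letter := (automaton n hn).accepts

/-- The partial permutation of `Σ` that fixes `a, b, d, e, f` and is undefined at `c`. -/
def omitC : Letter ≃. Letter := PEquiv.ofSet {x | x ≠ Letter.c}

/-- The dialect `L_n(a,b,-,d,e,f)`, a language over the alphabet `{a, b, d, e, f}`. -/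
def streamOmitC (n : ℕ) (hn : 5 ≤ n) : Language (DialectAlphabet omitC) :=
  dialect omitC (stream n hn)

end IdealStream

/-!
The words accepted by a Boolean combination of the two languages are recognised by the direct
product of the two DFAs, whose `m * n` states are all reachable: since `m ≠ n`, the cycles `a` have
different lengths, and `a`, `b` act transitively on the pairs of states different from `1` and from
the final ones; the letters `d`, `e`, `f` lead into the remaining pairs. It is left to decide which
states are equivalent. The final state of each DFA is a sink, and words over `{a, b}` followed by
`f` bring any chosen state of one DFA other than `1` to its final state and no other non-final one,
while keeping a given non-final state of the other DFA non-final. Hence only the states that the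
sinks make indistinguishable are equivalent: none for `∩` and `⊕`, the `m` pairs with final second
component for `\`, and the `m + n - 1` pairs with a final component for `∪`.
-/

namespace IdealStream

variable {α σ τ : Type*}

section Automata

variable {M : DFA α σ}

theorem acceptsFrom_evalFrom (s : σ) (w : List α) :
    M.acceptsFrom (M.evalFrom s w) = (M.acceptsFrom s).leftQuotient w := by
  ext u
  simp only [Language.mem_leftQuotient, DFA.mem_acceptsFrom, DFA.evalFrom_of_append]

theorem eq_of_acceptsFrom_eq_of_semiconj {P : DFA α τ} {f : τ → σ}
    (hf : ∀ s w, f (P.evalFrom s w) = M.evalFrom (f s) w) (hM : Function.Injective M.acceptsFrom)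
    (hP : ∀ s t, f s ∈ M.accept → f t ∉ M.accept → P.acceptsFrom s ≠ P.acceptsFrom t)
    {s t : τ} (hst : P.acceptsFrom s = P.acceptsFrom t) : f s = f t := by
  have mem_of_mem : ∀ {s t}, P.acceptsFrom s = P.acceptsFrom t → ∀ w,
      M.evalFrom (f s) w ∈ M.accept → M.evalFrom (f t) w ∈ M.accept := by
    intro s t hst w hs
    by_contra ht
    rw [← hf] at hs ht
    exact hP _ _ hs ht (by rw [acceptsFrom_evalFrom, acceptsFrom_evalFrom, hst])
  exact hM (Set.ext fun w => ⟨mem_of_mem hst w, mem_of_mem hst.symm w⟩)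

theorem range_leftQuotient_accepts (hM : Function.Surjective M.eval) :
    Set.range M.accepts.leftQuotient = Set.range M.acceptsFrom := by
  rw [Language.leftQuotient_accepts, hM.range_comp]

theorem complexity_accepts_of_injective (hM : Function.Surjective M.eval)
    (hinj : Function.Injective M.acceptsFrom) :
    complexity M.accepts = ENat.card σ := by
  rw [complexity, range_leftQuotient_accepts hM, ← Set.image_univ, hinj.encard_image,
    Set.encard_univ]

theorem complexity_accepts_of_collapse_compl [Finite σ] (hM : Function.Surjective M.eval)
    {D : Set σ} (hD : Dᶜ.Nonempty)
    (hMD : ∀ s t, M.acceptsFrom s = M.acceptsFrom t ↔ s = t ∨ s ∉ D ∧ t ∉ D) :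
    complexity M.accepts = (D.ncard + 1 : ℕ) := by
  obtain ⟨c, hc⟩ := hD
  have hrange : Set.range M.acceptsFrom = M.acceptsFrom '' insert c D := by
    refine (Set.range_subset_iff.2 fun s => ?_).antisymm (Set.image_subset_range _ _)
    by_cases hs : s ∈ D
    · exact ⟨s, Set.mem_insert_of_mem _ hs, rfl⟩
    · exact ⟨c, Set.mem_insert _ _, (hMD c s).2 (.inr ⟨hc, hs⟩)⟩
  have hinj : Set.InjOn M.acceptsFrom (insert c D) := by
    intro s hs t ht hst
    rcases (hMD s t).1 hst with h | ⟨hsD, htD⟩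
    · exact h
    · exact (hs.resolve_right hsD).trans (ht.resolve_right htD).symm
  rw [complexity, range_leftQuotient_accepts hM, hrange, hinj.encard_image,
    ← (Set.toFinite _).cast_ncard_eq, Set.ncard_insert_of_notMem hc]

end Automata

section BoolProduct

/-- The direct product of two DFAs in which a pair of states is final if `op` holds of the
finality of its components; it recognises the Boolean combination `op` of the two languages. -/
def boolProduct (op : Prop → Prop → Prop) (M : DFA α σ) (N : DFA α τ) : DFA α (σ × τ) where
  step x a := (M.step x.1 a, N.step x.2 a)
  start := (M.start, N.start)
  accept := {x | op (x.1 ∈ M.accept) (x.2 ∈ N.accept)}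

variable {op : Prop → Prop → Prop} {M : DFA α σ} {N : DFA α τ}

theorem evalFrom_boolProduct (x : σ × τ) (w : List α) :
    (boolProduct op M N).evalFrom x w = (M.evalFrom x.1 w, N.evalFrom x.2 w) := by
  induction w generalizing x with
  | nil => rfl
  | cons a _ ih => exact ih _

theorem injective_step_boolProduct {a : α} (hM : Function.Injective (M.step · a))
    (hN : Function.Injective (N.step · a)) :
    Function.Injective ((boolProduct op M N).step · a) :=
  hM.prodMap hN

theorem mem_acceptsFrom_boolProduct {x : σ × τ} {w : List α} :
    w ∈ (boolProduct op M N).acceptsFrom x ↔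
      op (M.evalFrom x.1 w ∈ M.accept) (N.evalFrom x.2 w ∈ N.accept) := by
  rw [DFA.mem_acceptsFrom, evalFrom_boolProduct, boolProduct, Set.mem_ofPred_eq]

theorem acceptsFrom_boolProduct_eq_iff {x y : σ × τ} :
    (boolProduct op M N).acceptsFrom x = (boolProduct op M N).acceptsFrom y ↔
      ∀ w, op (M.evalFrom x.1 w ∈ M.accept) (N.evalFrom x.2 w ∈ N.accept) ↔
        op (M.evalFrom y.1 w ∈ M.accept) (N.evalFrom y.2 w ∈ N.accept) := by
  simp only [← mem_acceptsFrom_boolProduct]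
  exact Set.ext_iff

theorem mem_accepts_boolProduct {w : List α} :
    w ∈ (boolProduct op M N).accepts ↔ op (w ∈ M.accepts) (w ∈ N.accepts) :=
  mem_acceptsFrom_boolProduct

theorem acceptsFrom_boolProduct_swap (hop : ∀ P Q, op P Q ↔ op Q P) (x : σ × τ) :
    (boolProduct op N M).acceptsFrom x.swap = (boolProduct op M N).acceptsFrom x := by
  ext w
  simp only [mem_acceptsFrom_boolProduct, Prod.fst_swap, Prod.snd_swap]
  exact hop _ _

theorem fst_eq_of_acceptsFrom_boolProduct_eq (hM : Function.Injective M.acceptsFrom)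
    (hop : ∀ x y : σ × τ, x.1 ∈ M.accept → y.1 ∉ M.accept →
      (boolProduct op M N).acceptsFrom x ≠ (boolProduct op M N).acceptsFrom y)
    {x y : σ × τ} (h : (boolProduct op M N).acceptsFrom x = (boolProduct op M N).acceptsFrom y) :
    x.1 = y.1 :=
  eq_of_acceptsFrom_eq_of_semiconj (fun _ _ => by rw [evalFrom_boolProduct]) hM hop h

theorem snd_eq_of_acceptsFrom_boolProduct_eq (hN : Function.Injective N.acceptsFrom)
    (hop : ∀ x y : σ × τ, x.2 ∈ N.accept → y.2 ∉ N.accept →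
      (boolProduct op M N).acceptsFrom x ≠ (boolProduct op M N).acceptsFrom y)
    {x y : σ × τ} (h : (boolProduct op M N).acceptsFrom x = (boolProduct op M N).acceptsFrom y) :
    x.2 = y.2 :=
  eq_of_acceptsFrom_eq_of_semiconj (fun _ _ => by rw [evalFrom_boolProduct]) hN hop h

end BoolProduct

section Ideals

/-- `M` has a non-final start state and exactly one final state, which no letter leaves. Such DFAs
recognise right ideals: a word with an accepted prefix is accepted. -/
structure HasAcceptingSink (M : DFA α σ) : Prop where
  exists_accept_eq : ∃ t, M.accept = {t}
  step_mem_accept : ∀ p ∈ M.accept, ∀ a, M.step p a ∈ M.accept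
  start_notMem_accept : M.start ∉ M.accept

theorem HasAcceptingSink.evalFrom_mem_accept {M : DFA α σ} (hM : HasAcceptingSink M) {p : σ}
    (hp : p ∈ M.accept) (w : List α) : M.evalFrom p w ∈ M.accept := by
  induction w generalizing p with
  | nil => exact hp
  | cons a _ ih => exact ih (hM.step_mem_accept p hp a)

theorem HasAcceptingSink.eq_of_mem_accept {M : DFA α σ} (hM : HasAcceptingSink M) {p q : σ}
    (hp : p ∈ M.accept) (hq : q ∈ M.accept) : p = q := by
  obtain ⟨t, ht⟩ := hM.exists_accept_eq
  rw [ht] at hp hq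
  exact hp.trans hq.symm

theorem HasAcceptingSink.nonempty_accept {M : DFA α σ} (hM : HasAcceptingSink M) :
    M.accept.Nonempty := by
  obtain ⟨t, ht⟩ := hM.exists_accept_eq
  exact ht ▸ Set.singleton_nonempty t

theorem HasAcceptingSink.mem_accept_of_evalFrom_mem_accept {M : DFA α σ} (hM : HasAcceptingSink M)
    {w : List α} (hw : Function.Injective (M.evalFrom · w)) {p : σ}
    (hp : M.evalFrom p w ∈ M.accept) : p ∈ M.accept := by
  obtain ⟨t, ht⟩ := hM.nonempty_accept
  exact hw (hM.eq_of_mem_accept hp (hM.evalFrom_mem_accept ht w)) ▸ ht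

/-- Words can be chosen to be accepted by `M`, and to tell non-final states of `M` apart, without
being accepted by `N`. Together with the same property of `(N, M)` it makes all Boolean
combinations of the two languages as complex as the sinks permit. -/
structure AcceptsIndependently (M : DFA α σ) (N : DFA α τ) : Prop where
  exists_mem_notMem : ∀ p, ∀ q ∉ N.accept, ∃ w,
    M.evalFrom p w ∈ M.accept ∧ N.evalFrom q w ∉ N.accept
  exists_separating : ∀ p ∉ M.accept, ∀ p' ∉ M.accept, p ≠ p' → ∀ q ∉ N.accept, ∀ q' ∉ N.accept,
    ∃ w, (M.evalFrom p w ∈ M.accept ∧ M.evalFrom p' w ∉ M.accept ∧ N.evalFrom q w ∉ N.accept) ∨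
      (M.evalFrom p' w ∈ M.accept ∧ M.evalFrom p w ∉ M.accept ∧ N.evalFrom q' w ∉ N.accept)

variable {M : DFA α σ} {N : DFA α τ}

theorem AcceptsIndependently.injective_acceptsFrom (h : AcceptsIndependently M N)
    (hM : HasAcceptingSink M) (hN : HasAcceptingSink N) : Function.Injective M.acceptsFrom := by
  intro p p' heq
  have hiff : ∀ w, M.evalFrom p w ∈ M.accept ↔ M.evalFrom p' w ∈ M.accept := Set.ext_iff.1 heq
  by_cases hp : p ∈ M.accept
  · exact hM.eq_of_mem_accept hp ((hiff []).1 hp)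
  · by_contra hne
    obtain ⟨w, hw⟩ := h.exists_separating p hp p' (fun hp' => hp ((hiff []).2 hp')) hne
      N.start hN.start_notMem_accept N.start hN.start_notMem_accept
    have := hiff w
    tauto

theorem injective_acceptsFrom_boolProduct_and (hM : HasAcceptingSink M) (hN : HasAcceptingSink N)
    (hMN : AcceptsIndependently M N) (hNM : AcceptsIndependently N M) :
    Function.Injective (boolProduct And M N).acceptsFrom := by
  intro x y hxy
  refine Prod.ext
    (fst_eq_of_acceptsFrom_boolProduct_eq (hMN.injective_acceptsFrom hM hN) ?_ hxy)
    (snd_eq_of_acceptsFrom_boolProduct_eq (hNM.injective_acceptsFrom hN hM) ?_ hxy)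
  · intro x y hx hy heq
    obtain ⟨w, hxw, hyw⟩ := hNM.exists_mem_notMem x.2 y.1 hy
    exact hyw ((acceptsFrom_boolProduct_eq_iff.1 heq w).1 ⟨hM.evalFrom_mem_accept hx w, hxw⟩).1
  · intro x y hx hy heq
    obtain ⟨w, hxw, hyw⟩ := hMN.exists_mem_notMem x.1 y.2 hy
    exact hyw ((acceptsFrom_boolProduct_eq_iff.1 heq w).1 ⟨hxw, hN.evalFrom_mem_accept hx w⟩).2

theorem acceptsFrom_boolProduct_xor_ne (hM : HasAcceptingSink M) (hN : HasAcceptingSink N)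
    (hMN : AcceptsIndependently M N) {x y : σ × τ} (hx : x.1 ∈ M.accept) (hy : y.1 ∉ M.accept) :
    (boolProduct Xor M N).acceptsFrom x ≠ (boolProduct Xor M N).acceptsFrom y := by
  intro heq
  have hiff := acceptsFrom_boolProduct_eq_iff.1 heq
  have hxM := hM.evalFrom_mem_accept hx
  have hfinality : x.2 ∈ N.accept ↔ y.2 ∉ N.accept := by
    have := hiff []
    simp only [DFA.evalFrom_nil, Xor] at this
    tauto
  by_cases hx' : x.2 ∈ N.accept
  · obtain ⟨w, hw, hw'⟩ := hMN.exists_mem_notMem y.1 y.2 (hfinality.1 hx')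
    have := hiff w
    have := hN.evalFrom_mem_accept hx' w
    simp_all [Xor]
  · obtain ⟨w, hw, hw'⟩ := hMN.exists_mem_notMem y.1 x.2 hx'
    have := hiff w
    have := hN.evalFrom_mem_accept (by tauto : y.2 ∈ N.accept) w
    simp_all [Xor]

theorem injective_acceptsFrom_boolProduct_xor (hM : HasAcceptingSink M) (hN : HasAcceptingSink N)
    (hMN : AcceptsIndependently M N) (hNM : AcceptsIndependently N M) :
    Function.Injective (boolProduct Xor M N).acceptsFrom := by
  intro x y hxy
  refine Prod.ext
    (fst_eq_of_acceptsFrom_boolProduct_eq (hMN.injective_acceptsFrom hM hN)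
      (fun _ _ => acceptsFrom_boolProduct_xor_ne hM hN hMN) hxy)
    (snd_eq_of_acceptsFrom_boolProduct_eq (hNM.injective_acceptsFrom hN hM) ?_ hxy)
  intro x y hx hy heq
  have hswap := acceptsFrom_boolProduct_swap (M := M) (N := N) fun P Q => (xor_comm P Q).to_iff
  exact acceptsFrom_boolProduct_xor_ne hN hM hNM (x := x.swap) (y := y.swap) hx hy
    (by rw [hswap, hswap, heq])

theorem acceptsFrom_boolProduct_andNot_eq_iff (hM : HasAcceptingSink M) (hN : HasAcceptingSink N)
    (hMN : AcceptsIndependently M N) (hNM : AcceptsIndependently N M) (x y : σ × τ) :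
    (boolProduct (fun P Q => P ∧ ¬Q) M N).acceptsFrom x =
        (boolProduct (fun P Q => P ∧ ¬Q) M N).acceptsFrom y ↔
      x = y ∨ x.2 ∈ N.accept ∧ y.2 ∈ N.accept := by
  constructor
  · intro heq
    have hiff := acceptsFrom_boolProduct_eq_iff.1 heq
    have hsnd : x.2 = y.2 := by
      refine snd_eq_of_acceptsFrom_boolProduct_eq (hNM.injective_acceptsFrom hN hM) ?_ heq
      intro x y hx hy heq
      obtain ⟨w, hw, hw'⟩ := hMN.exists_mem_notMem y.1 y.2 hy
      exact ((acceptsFrom_boolProduct_eq_iff.1 heq w).2 ⟨hw, hw'⟩).2 (hN.evalFrom_mem_accept hx w)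
    refine or_iff_not_imp_right.2 fun hxy => Prod.ext ?_ hsnd
    have hx : x.2 ∉ N.accept := fun hx => hxy ⟨hx, hsnd ▸ hx⟩
    have hy : y.2 ∉ N.accept := hsnd ▸ hx
    have hfst : x.1 ∈ M.accept ↔ y.1 ∈ M.accept := by simpa [hx, hy] using hiff []
    by_cases hxM : x.1 ∈ M.accept
    · exact hM.eq_of_mem_accept hxM (hfst.1 hxM)
    · by_contra hne
      obtain ⟨w, hw⟩ := hMN.exists_separating x.1 hxM y.1 (hfst.not.1 hxM) hne x.2 hx y.2 hy
      have := hiff w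
      tauto
  · rintro (rfl | ⟨hx, hy⟩)
    · rfl
    · refine acceptsFrom_boolProduct_eq_iff.2 fun w => ?_
      simp only [hN.evalFrom_mem_accept hx w, hN.evalFrom_mem_accept hy w, not_true, and_false]

theorem acceptsFrom_boolProduct_or_eq_iff (hM : HasAcceptingSink M) (hN : HasAcceptingSink N)
    (hMN : AcceptsIndependently M N) (hNM : AcceptsIndependently N M) (x y : σ × τ) :
    (boolProduct Or M N).acceptsFrom x = (boolProduct Or M N).acceptsFrom y ↔
      x = y ∨ (x.1 ∈ M.accept ∨ x.2 ∈ N.accept) ∧ (y.1 ∈ M.accept ∨ y.2 ∈ N.accept) := by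
  constructor
  · intro heq
    have hiff := acceptsFrom_boolProduct_eq_iff.1 heq
    have hnil : x.1 ∈ M.accept ∨ x.2 ∈ N.accept ↔ y.1 ∈ M.accept ∨ y.2 ∈ N.accept := hiff []
    refine or_iff_not_imp_right.2 fun hxy => ?_
    obtain ⟨hx, hx'⟩ : x.1 ∉ M.accept ∧ x.2 ∉ N.accept := by tauto
    obtain ⟨hy, hy'⟩ : y.1 ∉ M.accept ∧ y.2 ∉ N.accept := by tauto
    refine Prod.ext ?_ ?_ <;> by_contra hne
    · obtain ⟨w, hw⟩ := hMN.exists_separating x.1 hx y.1 hy hne y.2 hy' x.2 hx'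
      have := hiff w
      tauto
    · obtain ⟨w, hw⟩ := hNM.exists_separating x.2 hx' y.2 hy' hne y.1 hy x.1 hx
      have := hiff w
      tauto
  · have accepts_all : ∀ {z : σ × τ}, z.1 ∈ M.accept ∨ z.2 ∈ N.accept → ∀ w,
        M.evalFrom z.1 w ∈ M.accept ∨ N.evalFrom z.2 w ∈ N.accept := fun hz w =>
      hz.imp (hM.evalFrom_mem_accept · w) (hN.evalFrom_mem_accept · w)
    rintro (rfl | ⟨hx, hy⟩)
    · rfl
    · exact acceptsFrom_boolProduct_eq_iff.2 fun w =>
        iff_of_true (accepts_all hx w) (accepts_all hy w)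

theorem HasAcceptingSink.ncard_compl_accept [Finite σ] (hM : HasAcceptingSink M) :
    M.acceptᶜ.ncard = Nat.card σ - 1 := by
  obtain ⟨t, ht⟩ := hM.exists_accept_eq
  rw [Set.ncard_compl, ht, Set.ncard_singleton]

theorem complexity_inf_accepts [Finite σ] [Finite τ] (hM : HasAcceptingSink M)
    (hN : HasAcceptingSink N) (hMN : AcceptsIndependently M N) (hNM : AcceptsIndependently N M)
    (hreach : Function.Surjective (boolProduct And M N).eval) :
    complexity (M.accepts ⊓ N.accepts) = (Nat.card σ * Nat.card τ : ℕ) := by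
  have haccepts : M.accepts ⊓ N.accepts = (boolProduct And M N).accepts :=
    Language.ext fun _ => mem_accepts_boolProduct.symm
  rw [haccepts, complexity_accepts_of_injective hreach
    (injective_acceptsFrom_boolProduct_and hM hN hMN hNM), ENat.card_eq_coe_natCard, Nat.card_prod]

theorem complexity_symmDiff_accepts [Finite σ] [Finite τ] (hM : HasAcceptingSink M)
    (hN : HasAcceptingSink N) (hMN : AcceptsIndependently M N) (hNM : AcceptsIndependently N M)
    (hreach : Function.Surjective (boolProduct Xor M N).eval) :
    complexity (symmDiff M.accepts N.accepts) = (Nat.card σ * Nat.card τ : ℕ) := by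
  have haccepts : symmDiff M.accepts N.accepts = (boolProduct Xor M N).accepts :=
    Language.ext fun _ => (mem_accepts_boolProduct (op := Xor)).symm
  rw [haccepts, complexity_accepts_of_injective hreach
    (injective_acceptsFrom_boolProduct_xor hM hN hMN hNM), ENat.card_eq_coe_natCard, Nat.card_prod]

theorem complexity_sdiff_accepts [Finite σ] [Finite τ] (hM : HasAcceptingSink M)
    (hN : HasAcceptingSink N) (hMN : AcceptsIndependently M N) (hNM : AcceptsIndependently N M)
    (hreach : Function.Surjective (boolProduct (fun P Q => P ∧ ¬Q) M N).eval) :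
    complexity (M.accepts \ N.accepts) = (Nat.card σ * (Nat.card τ - 1) + 1 : ℕ) := by
  have haccepts : M.accepts \ N.accepts = (boolProduct (fun P Q => P ∧ ¬Q) M N).accepts :=
    Language.ext fun _ => (mem_accepts_boolProduct (op := fun P Q => P ∧ ¬Q)).symm
  obtain ⟨t, ht⟩ := hN.nonempty_accept
  rw [haccepts, complexity_accepts_of_collapse_compl hreach
      (D := Set.univ ×ˢ N.acceptᶜ) ⟨(M.start, t), by simpa using ht⟩ fun x y => by
        simpa using acceptsFrom_boolProduct_andNot_eq_iff hM hN hMN hNM x y,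
    Set.ncard_prod, Set.ncard_univ, hN.ncard_compl_accept]

theorem complexity_sup_accepts [Finite σ] [Finite τ] (hM : HasAcceptingSink M)
    (hN : HasAcceptingSink N) (hMN : AcceptsIndependently M N) (hNM : AcceptsIndependently N M)
    (hreach : Function.Surjective (boolProduct Or M N).eval) :
    complexity (M.accepts ⊔ N.accepts) = ((Nat.card σ - 1) * (Nat.card τ - 1) + 1 : ℕ) := by
  have haccepts : M.accepts ⊔ N.accepts = (boolProduct Or M N).accepts :=
    Language.ext fun _ => mem_accepts_boolProduct.symm
  obtain ⟨t, ht⟩ := hN.nonempty_accept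
  rw [haccepts, complexity_accepts_of_collapse_compl hreach
      (D := M.acceptᶜ ×ˢ N.acceptᶜ) ⟨(M.start, t), by simp [ht]⟩ fun x y => by
        simpa only [Set.mem_prod, Set.mem_compl_iff, not_and_or, not_not] using
          acceptsFrom_boolProduct_or_eq_iff hM hN hMN hNM x y,
    Set.ncard_prod, hM.ncard_compl_accept, hN.ncard_compl_accept]

end Ideals

section Dialect

theorem dialect_ofSet (s : Set α) [DecidablePred (· ∈ s)] (L : Language α) :
    dialect (PEquiv.ofSet s) L = List.map Subtype.val ⁻¹' L := by
  have ofSet_eq_some_iff (x : α) (y : DialectAlphabet (PEquiv.ofSet s)) :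
      PEquiv.ofSet s x = some y.val ↔ x = y.val := by
    obtain ⟨y, z, hz⟩ := y
    have hy : y ∈ s := (PEquiv.mem_ofSet_iff.1 hz).2
    rw [PEquiv.ofSet_eq_some_iff, and_iff_left hy, eq_comm]
  have map_eq_iff (u : List α) (w : List (DialectAlphabet (PEquiv.ofSet s))) :
      u.map (PEquiv.ofSet s) = w.map (fun y => some y.val) ↔ u = w.map Subtype.val := by
    simp only [← List.forall₂_eq_eq_eq, List.forall₂_map_left_iff, List.forall₂_map_right_iff,
      ofSet_eq_some_iff]
  ext w
  change (∃ u ∈ L, _) ↔ w.map Subtype.val ∈ L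
  simp only [map_eq_iff, exists_eq_right]

end Dialect

section Reaches

variable {M : DFA α σ} {N : DFA α τ} {A : Set α}

/-- Reachability of states by words over the subalphabet `A`. -/
abbrev Reaches (M : DFA α σ) (A : Set α) : σ → σ → Prop :=
  Relation.ReflTransGen fun s t => ∃ a ∈ A, M.step s a = t

theorem Reaches.iterate_step {a : α} (ha : a ∈ A) (s : σ) (k : ℕ) :
    Reaches M A s ((M.step · a)^[k] s) := by
  induction k with
  | zero => exact .refl
  | succ k ih =>
    rw [Function.iterate_succ_apply']
    exact ih.tail ⟨a, ha, rfl⟩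

theorem Reaches.symm [Finite σ] (hA : ∀ a ∈ A, Function.Injective (M.step · a)) {s t : σ}
    (h : Reaches M A s t) : Reaches M A t s := by
  induction h with
  | refl => exact .refl
  | @tail t _ _ hstep ih =>
    obtain ⟨a, ha, rfl⟩ := hstep
    obtain ⟨k, hk, hperiod⟩ := (hA a ha).mem_periodicPts t
    obtain ⟨j, rfl⟩ := Nat.exists_eq_succ_of_ne_zero hk.ne'
    have hback : Reaches M A (M.step t a) t := by
      simpa only [← Function.iterate_succ_apply, hperiod.eq] using
        Reaches.iterate_step (M := M) ha (M.step t a) j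
    exact hback.trans ih

theorem Reaches.exists_evalFrom_eq {s t : σ} (h : Reaches M A s t) :
    ∃ w, (∀ a ∈ w, a ∈ A) ∧ M.evalFrom s w = t := by
  induction h using Relation.ReflTransGen.head_induction_on with
  | refl => exact ⟨[], by simp, rfl⟩
  | head hstep _ ih =>
    obtain ⟨a, ha, rfl⟩ := hstep
    obtain ⟨w, hw, rfl⟩ := ih
    exact ⟨a :: w, List.forall_mem_cons.2 ⟨ha, hw⟩, rfl⟩

theorem Reaches.mem_range_eval {s t : σ} (h : Reaches M A s t) (hs : s ∈ Set.range M.eval) :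
    t ∈ Set.range M.eval := by
  obtain ⟨w, -, rfl⟩ := h.exists_evalFrom_eq
  obtain ⟨u, rfl⟩ := hs
  exact ⟨u ++ w, M.evalFrom_of_append _ u w⟩

theorem Reaches.boolProduct_swap {op op' : Prop → Prop → Prop} {x y : σ × τ}
    (h : Reaches (boolProduct op M N) A x y) :
    Reaches (boolProduct op' N M) A x.swap y.swap := by
  refine h.lift Prod.swap ?_
  rintro _ _ ⟨a, ha, rfl⟩
  exact ⟨a, ha, rfl⟩

theorem swap_mem_range_eval_boolProduct {op op' : Prop → Prop → Prop} {x : σ × τ}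
    (hx : x ∈ Set.range (boolProduct op M N).eval) :
    x.swap ∈ Set.range (boolProduct op' N M).eval := by
  obtain ⟨w, rfl⟩ := hx
  exact ⟨w, by simp only [DFA.eval, evalFrom_boolProduct]; rfl⟩

theorem injective_evalFrom_of_forall_mem (hA : ∀ a ∈ A, Function.Injective (M.step · a))
    {w : List α} (hw : ∀ a ∈ w, a ∈ A) : Function.Injective (M.evalFrom · w) := by
  induction w with
  | nil => exact Function.injective_id
  | cons a w ih =>
    obtain ⟨ha, hw⟩ := List.forall_mem_cons.1 hw
    exact (ih hw).comp (hA a ha)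

end Reaches

section States

variable {n : ℕ}

instance : Finite (State n) := inferInstanceAs (Finite (Set.Icc 1 n))

theorem natCard_state (n : ℕ) : Nat.card (State n) = n := by
  change Nat.card (Set.Icc 1 n) = n
  rw [Nat.card_coe_set_eq, Set.ncard_eq_toFinset_card', Set.toFinset_Icc, Nat.card_Icc,
    Nat.add_sub_cancel]

/-- The states `2, …, n - 1`, on which `a` and `b` generate the symmetric group. -/
def IsInner (q : State n) : Prop := 2 ≤ q.val ∧ q.val < n

theorem eq_one_or_isInner_or_eq (q : State n) : q.val = 1 ∨ IsInner q ∨ q.val = n := by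
  have := q.property
  unfold IsInner
  omega

/-- The DFA obtained from `automaton n hn` by deleting the letter `c`. -/
def omitCAutomaton (n : ℕ) (hn : 5 ≤ n) : DFA (DialectAlphabet omitC) (State n) :=
  (automaton n hn).comap Subtype.val

theorem streamOmitC_eq_accepts (hn : 5 ≤ n) :
    streamOmitC n hn = (omitCAutomaton n hn).accepts := by
  rw [omitCAutomaton, DFA.accepts_comap]
  exact dialect_ofSet _ _

theorem hasAcceptingSink_omitCAutomaton (hn : 5 ≤ n) :
    HasAcceptingSink (omitCAutomaton n hn) where
  exists_accept_eq :=
    ⟨⟨n, by omega, le_rfl⟩, Set.ext fun _ => (Subtype.ext_iff (a2 := ⟨n, _⟩)).symm⟩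
  step_mem_accept := by
    rintro p hp ⟨x, -⟩
    change p.val = n at hp
    change act n x p.val = n
    cases x <;> simp only [act] <;> split_ifs <;> omega
  start_notMem_accept := show 1 ≠ n by omega

/-- A letter other than `c`, as a letter of the dialect's alphabet. -/
abbrev letter (x : Letter) (hx : x ≠ .c := by decide) : DialectAlphabet omitC :=
  ⟨x, x, PEquiv.mem_ofSet_self_iff.2 hx⟩

/-- The letters `a` and `b`, which act as permutations fixing `1` and `n`. -/
def permLetters : Set (DialectAlphabet omitC) := {letter .a, letter .b}

theorem a_mem_permLetters : letter .a ∈ permLetters := .inl rfl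
theorem b_mem_permLetters : letter .b ∈ permLetters := .inr rfl

theorem injective_step_of_mem_permLetters (hn : 5 ≤ n) :
    ∀ x ∈ permLetters, Function.Injective ((omitCAutomaton n hn).step · x) := by
  intro x hx p q hpq
  have hact : act n x.val p.val = act n x.val q.val := congrArg Subtype.val hpq
  apply Subtype.ext
  rcases hx with rfl | rfl <;> simp only [act] at hact <;> split_ifs at hact <;> omega

theorem step_a_of_not_isInner {hn : 5 ≤ n} {q : State n} (hq : ¬IsInner q) :
    (omitCAutomaton n hn).step q (letter .a) = q := by
  refine Subtype.ext (show act n .a q.val = q.val from ?_)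
  rcases eq_one_or_isInner_or_eq q with h | h | h <;> grind [act]

theorem step_e_of_notMem_accept {hn : 5 ≤ n} {q : State n} (hq : q ∉ (omitCAutomaton n hn).accept) :
    (omitCAutomaton n hn).step q (letter .e) = ⟨2, by omega⟩ := by
  have hqn : q.val ≠ n := hq
  exact Subtype.ext (if_pos (by have := q.property; omega))

theorem step_f_mem_accept_iff {hn : 5 ≤ n} {q : State n} :
    (omitCAutomaton n hn).step q (letter .f) ∈ (omitCAutomaton n hn).accept ↔
      q.val = 2 ∨ q ∈ (omitCAutomaton n hn).accept := by
  change act n .f q.val = n ↔ q.val = 2 ∨ q.val = n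
  grind [act]

end States

section Product

variable {m n : ℕ} {hm : 5 ≤ m} {hn : 5 ≤ n} {op : Prop → Prop → Prop}

/-- The product of the DFAs of the `m`-th and the `n`-th language. -/
abbrev productAutomaton (op : Prop → Prop → Prop) (hm : 5 ≤ m) (hn : 5 ≤ n) :
    DFA (DialectAlphabet omitC) (State m × State n) :=
  boolProduct op (omitCAutomaton m hm) (omitCAutomaton n hn)

theorem reaches_of_act {A : Set (DialectAlphabet omitC)} {x : DialectAlphabet omitC} (hx : x ∈ A)
    {s t : State m × State n} (hfst : act m x.val s.1.val = t.1.val)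
    (hsnd : act n x.val s.2.val = t.2.val) : Reaches (productAutomaton op hm hn) A s t :=
  .single ⟨x, hx, Prod.ext (Subtype.ext hfst) (Subtype.ext hsnd)⟩

theorem reaches_permLetters_symm {s t : State m × State n}
    (h : Reaches (productAutomaton op hm hn) permLetters s t) :
    Reaches (productAutomaton op hm hn) permLetters t s :=
  h.symm fun x hx => injective_step_boolProduct (injective_step_of_mem_permLetters hm x hx)
    (injective_step_of_mem_permLetters hn x hx)

theorem reaches_iterate_step_a (k : ℕ) (hk : k + 2 < m) (q : State n) :
    Reaches (productAutomaton op hm hn) permLetters (⟨2, by omega⟩, q)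
      (⟨k + 2, by omega⟩, ((omitCAutomaton n hn).step · (letter .a))^[k] q) := by
  induction k with
  | zero => exact .refl
  | succ k ih =>
    rw [Function.iterate_succ_apply']
    exact (ih (by omega)).trans (reaches_of_act a_mem_permLetters (by grind [act]) rfl)

theorem exists_reaches_two {p : State m} (hp : IsInner p) {q : State n} (hq : IsInner q) :
    ∃ q₀ : State n, IsInner q₀ ∧
      Reaches (productAutomaton op hm hn) permLetters (p, q) (⟨2, by omega⟩, q₀) := by
  obtain ⟨p, _⟩ := p
  obtain ⟨k, rfl⟩ := Nat.exists_eq_add_of_le' hp.1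
  have hinj := injective_step_of_mem_permLetters hn _ a_mem_permLetters
  obtain ⟨q₀, rfl⟩ := (Finite.surjective_of_injective (hinj.iterate k)) q
  refine ⟨q₀, ?_, reaches_permLetters_symm (reaches_iterate_step_a k hp.2 q₀)⟩
  by_contra hq₀
  rw [Function.iterate_fixed (step_a_of_not_isInner hq₀)] at hq
  exact hq₀ hq

theorem reaches_two_of_not_isInner {p : State m} (hp : IsInner p) {q : State n} (hq : ¬IsInner q) :
    Reaches (productAutomaton op hm hn) permLetters (p, q) (⟨2, by omega⟩, q) := by
  obtain ⟨p, _⟩ := p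
  obtain ⟨k, rfl⟩ := Nat.exists_eq_add_of_le' hp.1
  have h := reaches_iterate_step_a (op := op) (hm := hm) (hn := hn) k hp.2 q
  rw [Function.iterate_fixed (step_a_of_not_isInner hq)] at h
  exact reaches_permLetters_symm h

theorem reaches_two_add_three (k : ℕ) (hk : k + 3 < n) :
    Reaches (productAutomaton op hm hn) permLetters
      (⟨2, by omega⟩, ⟨3, by omega⟩) (⟨2, by omega⟩, ⟨k + 3, by omega⟩) := by
  induction k with
  | zero => exact .refl
  | succ k ih =>
    have ha : Reaches (productAutomaton op hm hn) permLetters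
        (⟨2, by omega⟩, ⟨k + 3, by omega⟩) (⟨3, by omega⟩, ⟨k + 4, by omega⟩) :=
      reaches_of_act a_mem_permLetters (by grind [act]) (by grind [act])
    have hb : Reaches (productAutomaton op hm hn) permLetters
        (⟨3, by omega⟩, ⟨k + 4, by omega⟩) (⟨2, by omega⟩, ⟨k + 4, by omega⟩) :=
      reaches_of_act b_mem_permLetters (by grind [act]) (by grind [act])
    exact ((ih (by omega)).trans ha).trans hb

theorem reaches_diagonal (k : ℕ) (hkm : k + 2 < m) (hkn : k + 2 < n) :
    Reaches (productAutomaton op hm hn) permLetters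
      (⟨2, by omega⟩, ⟨2, by omega⟩) (⟨k + 2, by omega⟩, ⟨k + 2, by omega⟩) := by
  induction k with
  | zero => exact .refl
  | succ k ih =>
    exact (ih (by omega) (by omega)).trans
      (reaches_of_act a_mem_permLetters (by grind [act]) (by grind [act]))

theorem reaches_two_three_of_lt (hmn : m < n) {x : State m × State n}
    (hfst : IsInner x.1) (hsnd : IsInner x.2) :
    Reaches (productAutomaton op hm hn) permLetters x (⟨2, by omega⟩, ⟨3, by omega⟩) := by
  obtain ⟨⟨q, _⟩, hq₀, hx⟩ := exists_reaches_two (op := op) (hm := hm) (hn := hn) hfst hsnd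
  refine hx.trans (reaches_permLetters_symm ?_)
  obtain rfl | hq : q = 2 ∨ 3 ≤ q := by grind [hq₀.1]
  · -- The shorter cycle wraps around first, which leads off the diagonal.
    have hwrap : Reaches (productAutomaton op hm hn) permLetters
        (⟨m - 3 + 2, by omega⟩, ⟨m - 3 + 2, by omega⟩) (⟨2, by omega⟩, ⟨m - 3 + 3, by omega⟩) :=
      reaches_of_act a_mem_permLetters (by grind [act]) (by grind [act])
    exact (reaches_two_add_three (m - 3) (by omega)).trans
      (reaches_permLetters_symm ((reaches_diagonal (m - 3) (by omega) (by omega)).trans hwrap))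
  · obtain ⟨k, rfl⟩ := Nat.exists_eq_add_of_le' hq
    exact reaches_two_add_three k hq₀.2

theorem reaches_of_isInner (hmn : m ≠ n) {x y : State m × State n} (hx₁ : IsInner x.1)
    (hx₂ : IsInner x.2) (hy₁ : IsInner y.1) (hy₂ : IsInner y.2) :
    Reaches (productAutomaton op hm hn) permLetters x y := by
  have of_lt : ∀ {m n : ℕ} {hm : 5 ≤ m} {hn : 5 ≤ n}, m < n → ∀ {x y : State m × State n},
      IsInner x.1 → IsInner x.2 → IsInner y.1 → IsInner y.2 →
      Reaches (productAutomaton op hm hn) permLetters x y := fun h _ _ hx₁ hx₂ hy₁ hy₂ =>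
    (reaches_two_three_of_lt h hx₁ hx₂).trans
      (reaches_permLetters_symm (reaches_two_three_of_lt h hy₁ hy₂))
  rcases hmn.lt_or_gt with hlt | hlt
  · exact of_lt hlt hx₁ hx₂ hy₁ hy₂
  · exact (of_lt (x := x.swap) (y := y.swap) hlt hx₂ hx₁ hy₂ hy₁).boolProduct_swap

theorem reaches_of_not_isInner_snd {p p' : State m} (hp : IsInner p) (hp' : IsInner p')
    {q : State n} (hq : ¬IsInner q) :
    Reaches (productAutomaton op hm hn) permLetters (p, q) (p', q) :=
  (reaches_two_of_not_isInner hp hq).trans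
    (reaches_permLetters_symm (reaches_two_of_not_isInner hp' hq))

theorem mem_range_eval_of_act (x : Letter) {s t : State m × State n}
    (hs : s ∈ Set.range (productAutomaton op hm hn).eval) (hfst : act m x s.1.val = t.1.val)
    (hsnd : act n x s.2.val = t.2.val) (hx : x ≠ .c := by decide) :
    t ∈ Set.range (productAutomaton op hm hn).eval :=
  (reaches_of_act (x := letter x hx) (Set.mem_univ _) hfst hsnd).mem_range_eval hs

theorem mem_range_eval_of_isInner (hmn : m ≠ n) {x : State m × State n} (hx₁ : IsInner x.1)
    (hx₂ : IsInner x.2) : x ∈ Set.range (productAutomaton op hm hn).eval := by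
  have hstart : (⟨1, by omega⟩, ⟨1, by omega⟩) ∈ Set.range (productAutomaton op hm hn).eval :=
    ⟨[], rfl⟩
  have htwo : (⟨2, by omega⟩, ⟨2, by omega⟩) ∈ Set.range (productAutomaton op hm hn).eval :=
    mem_range_eval_of_act .e hstart (by grind [act]) (by grind [act])
  exact (reaches_of_isInner hmn ⟨le_rfl, by grind⟩ ⟨le_rfl, by grind⟩ hx₁ hx₂).mem_range_eval htwo

theorem mem_range_eval_of_isInner_fst (hmn : m ≠ n) {x : State m × State n} (hx : IsInner x.1) :
    x ∈ Set.range (productAutomaton op hm hn).eval := by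
  have inner_mem : ∀ p q (hp : 2 ≤ p ∧ p < m) (hq : 2 ≤ q ∧ q < n),
      (⟨p, by omega⟩, ⟨q, by omega⟩) ∈ Set.range (productAutomaton op hm hn).eval :=
    fun p q hp hq => mem_range_eval_of_isInner hmn hp hq
  obtain ⟨p, q⟩ := x
  by_cases hq : IsInner q
  · exact mem_range_eval_of_isInner hmn hx hq
  suffices h : ∃ p₀ : State m, IsInner p₀ ∧
      (p₀, q) ∈ Set.range (productAutomaton op hm hn).eval by
    obtain ⟨p₀, hp₀, hmem⟩ := h
    exact (reaches_of_not_isInner_snd hp₀ hx hq).mem_range_eval hmem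
  rcases eq_one_or_isInner_or_eq q with hq₁ | hq' | hqn
  · exact ⟨⟨2, by omega⟩, ⟨le_rfl, by grind⟩, mem_range_eval_of_act .d
      (inner_mem 2 (n - 1) (by omega) (by omega)) (by grind [act]) (by grind [act])⟩
  · exact absurd hq' hq
  · exact ⟨⟨3, by omega⟩, ⟨by grind, by grind⟩, mem_range_eval_of_act .f
      (inner_mem 3 2 (by omega) (by omega)) (by grind [act]) (by grind [act])⟩

theorem surjective_eval_productAutomaton (op : Prop → Prop → Prop) (hm : 5 ≤ m) (hn : 5 ≤ n)
    (hmn : m ≠ n) : Function.Surjective (productAutomaton op hm hn).eval := by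
  have mem_of_isInner_snd : ∀ {p : State m} {q : State n}, IsInner q →
      (p, q) ∈ Set.range (productAutomaton op hm hn).eval := fun hq =>
    swap_mem_range_eval_boolProduct (op := op)
      (mem_range_eval_of_isInner_fst (hm := hn) (hn := hm) hmn.symm (x := (_, _)) hq)
  rintro ⟨p, q⟩
  change (p, q) ∈ Set.range (productAutomaton op hm hn).eval
  rcases eq_one_or_isInner_or_eq p with hp | hp | hp
  · rcases eq_one_or_isInner_or_eq q with hq | hq | hq
    · exact ⟨[], Prod.ext (Subtype.ext hp.symm) (Subtype.ext hq.symm)⟩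
    · exact mem_of_isInner_snd hq
    · exact mem_range_eval_of_act .d
        (mem_range_eval_of_isInner_fst hmn (x := (⟨m - 1, by omega⟩, q)) ⟨by grind, by grind⟩)
        (by grind [act]) (by grind [act])
  · exact mem_range_eval_of_isInner_fst hmn hp
  · rcases eq_one_or_isInner_or_eq q with hq | hq | hq
    · exact mem_range_eval_of_act .d
        (mem_of_isInner_snd (p := p) (q := ⟨n - 1, by omega⟩) ⟨by grind, by grind⟩)
        (by grind [act]) (by grind [act])
    · exact mem_of_isInner_snd hq
    · exact mem_range_eval_of_act .f
        (mem_of_isInner_snd (p := ⟨2, by omega⟩) (q := ⟨2, by omega⟩) ⟨by grind, by grind⟩)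
        (by grind [act]) (by grind [act])

theorem exists_reaches_two_ne_two (hmn : m ≠ n) {p : State m} (hp : IsInner p) {q : State n}
    (hq : q.val ≠ n) : ∃ q₀ : State n, q₀.val ≠ 2 ∧ q₀.val ≠ n ∧
      Reaches (productAutomaton op hm hn) permLetters (p, q) (⟨2, by omega⟩, q₀) := by
  by_cases hq' : IsInner q
  · exact ⟨⟨3, by omega⟩, by grind, by grind, reaches_of_isInner hmn hp hq'
      ⟨le_rfl, by grind⟩ ⟨by grind, by grind⟩⟩
  · exact ⟨q, fun h => hq' ⟨h.ge, by grind⟩, hq, reaches_two_of_not_isInner hp hq'⟩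

theorem exists_accepting_only (hmn : m ≠ n) {p : State m} (hp : IsInner p) {q : State n}
    (hq : q ∉ (omitCAutomaton n hn).accept) :
    ∃ w, (omitCAutomaton m hm).evalFrom p w ∈ (omitCAutomaton m hm).accept ∧
      (omitCAutomaton n hn).evalFrom q w ∉ (omitCAutomaton n hn).accept ∧
      ∀ p' ∉ (omitCAutomaton m hm).accept, p' ≠ p →
        (omitCAutomaton m hm).evalFrom p' w ∉ (omitCAutomaton m hm).accept := by
  obtain ⟨q₀, hq₀, hq₀n, hreach⟩ :=
    exists_reaches_two_ne_two (op := And) (hm := hm) (hn := hn) hmn hp hq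
  obtain ⟨u, hu, heval⟩ := hreach.exists_evalFrom_eq
  rw [evalFrom_boolProduct, Prod.mk.injEq] at heval
  obtain ⟨hpu, hqu⟩ := heval
  have hinj : Function.Injective ((omitCAutomaton m hm).evalFrom · u) :=
    injective_evalFrom_of_forall_mem (injective_step_of_mem_permLetters hm) hu
  refine ⟨u ++ [letter .f], ?_, ?_, fun p' hp' hne => ?_⟩ <;>
    rw [DFA.evalFrom_append_singleton, step_f_mem_accept_iff]
  · exact .inl (congrArg Subtype.val hpu)
  · rw [hqu]
    exact not_or.2 ⟨hq₀, hq₀n⟩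
  · rintro (hp'u | hp'u)
    · exact hne (hinj (Subtype.ext (hp'u.trans (congrArg Subtype.val hpu).symm)))
    · exact hp' ((hasAcceptingSink_omitCAutomaton hm).mem_accept_of_evalFrom_mem_accept hinj hp'u)

theorem acceptsIndependently_omitCAutomaton (hm : 5 ≤ m) (hn : 5 ≤ n) (hmn : m ≠ n) :
    AcceptsIndependently (omitCAutomaton m hm) (omitCAutomaton n hn) where
  exists_mem_notMem p q hq := by
    by_cases hp : p ∈ (omitCAutomaton m hm).accept
    · exact ⟨[], hp, hq⟩
    obtain ⟨w, hpw, hqw, -⟩ := exists_accepting_only (hm := hm) (hn := hn) hmn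
      (p := ⟨2, by omega⟩) ⟨le_rfl, by grind⟩ (q := ⟨2, by omega⟩) (show 2 ≠ n by omega)
    refine ⟨letter .e :: w, ?_, ?_⟩ <;> rw [DFA.evalFrom_cons]
    · rwa [step_e_of_notMem_accept hp]
    · rwa [step_e_of_notMem_accept hq]
  exists_separating p hp p' hp' hne q hq q' hq' := by
    rcases eq_one_or_isInner_or_eq p with hp₁ | hpI | hpm
    · have hp'₁ : p'.val ≠ 1 := fun hp'₁ => hne (Subtype.ext (hp₁.trans hp'₁.symm))
      have hp'I : IsInner p' :=
        ((eq_one_or_isInner_or_eq p').resolve_left hp'₁).resolve_right hp'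
      obtain ⟨w, hw, hwq, hwp⟩ := exists_accepting_only hmn hp'I hq'
      exact ⟨w, .inr ⟨hw, hwp p hp hne, hwq⟩⟩
    · obtain ⟨w, hw, hwq, hwp⟩ := exists_accepting_only hmn hpI hq
      exact ⟨w, .inl ⟨hw, hwp p' hp' hne.symm, hwq⟩⟩
    · exact absurd hpm hp

end Product

end IdealStream

theorem mainTheorem5 (m n : ℕ) (hm : 5 ≤ m) (hn : 5 ≤ n) (hmn : m ≠ n) :
    IdealStream.complexity
        (IdealStream.streamOmitC m hm ⊓ IdealStream.streamOmitC n hn) = ((m * n : ℕ) : ℕ∞) ∧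
    IdealStream.complexity
        (symmDiff (IdealStream.streamOmitC m hm) (IdealStream.streamOmitC n hn)) =
      ((m * n : ℕ) : ℕ∞) ∧
    IdealStream.complexity
        (IdealStream.streamOmitC m hm \ IdealStream.streamOmitC n hn) =
      ((m * n - (m - 1) : ℕ) : ℕ∞) ∧
    IdealStream.complexity
        (IdealStream.streamOmitC m hm ⊔ IdealStream.streamOmitC n hn) =
      ((m * n - (m + n - 2) : ℕ) : ℕ∞) := by
  open IdealStream in
  have hM := hasAcceptingSink_omitCAutomaton hm
  have hN := hasAcceptingSink_omitCAutomaton hn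
  have hMN := acceptsIndependently_omitCAutomaton hm hn hmn
  have hNM := acceptsIndependently_omitCAutomaton hn hm hmn.symm
  have hreach op := surjective_eval_productAutomaton op hm hn hmn
  have card_sdiff : m * (n - 1) + 1 = m * n - (m - 1) := by
    rw [Nat.mul_sub_one]
    have := Nat.le_mul_of_pos_right m (by omega : 0 < n)
    omega
  have card_sup : (m - 1) * (n - 1) + 1 = m * n - (m + n - 2) := by
    obtain ⟨m, rfl⟩ := Nat.exists_eq_add_of_le' hm
    obtain ⟨n, rfl⟩ := Nat.exists_eq_add_of_le' hn
    grind
  rw [streamOmitC_eq_accepts, streamOmitC_eq_accepts,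
    complexity_inf_accepts hM hN hMN hNM (hreach _),
    complexity_symmDiff_accepts hM hN hMN hNM (hreach _),
    complexity_sdiff_accepts hM hN hMN hNM (hreach _),
    complexity_sup_accepts hM hN hMN hNM (hreach _),
    natCard_state, natCard_state, card_sdiff, card_sup]
  exact ⟨rfl, rfl, rfl, rfl⟩
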